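/- Let $(\Omega,\mathcal F,\mathbb P)$ be an atomless probability space and let $L^\infty$ be the set of essentially bounded real random variables on it. For $X\in L^\infty$, $\alpha\in[0,1]$ and a decreasing (in the weak sense) function $\Lambda:\mathbb R\to[0,1]$ put, with infima and suprema taken in $[-\infty,\infty]$, $$\mathrm{VaR}_\alpha(X)=\inf\{x\in\mathbb R:\mathbb P(X\le x)\ge\alpha\},\qquad \mathrm{VaR}_\Lambda(X)=\inf\{x\in\mathbb R:\mathbb P(X\le x)\ge\Lambda(x)\},$$ $$\mathrm{ES}_\alpha(X)=\frac1{1-\alpha}\int_\alpha^1\mathrm{VaR}_\beta(X)\,\mathrm d\beta\ \text{ for }\alpha<1,\qquad \mathrm{ES}_1(X)=\mathrm{VaR}_1(X),$$ $$\mathrm{ES}_\Lambda(X)=\sup_{x\in\mathbb R}\min\{\mathrm{ES}_{\Lambda(x)}(X),x\}.$$ **Proposition 3.5.** For any decreasing functions $\Lambda,\Lambda':\mathbb R\to[0,1]$, $\mathrm{ES}_\Lambda$ is finite on $L^\infty$ and has the following properties. (a) If $\Lambda\ge\Lambda'$ pointwise, then $\mathrm{ES}_\Lambda(X)\ge\mathrm{ES}_{\Lambda'}(X)$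 for all $X\in L^\infty$. (b) Monotonicity: $\mathrm{ES}_\Lambda(X)\ge\mathrm{ES}_\Lambda(Y)$ for all $X,Y\in L^\infty$ with $X\ge Y$ almost surely. (c) $\mathrm{ES}_\Lambda(X)\ge\mathrm{VaR}_\Lambda(X)$ for all $X\in L^\infty$. (d) Quasi-convexity: $\mathrm{ES}_\Lambda(\gamma X+(1-\gamma)Y)\le\max\{\mathrm{ES}_\Lambda(X),\mathrm{ES}_\Lambda(Y)\}$ for all $X,Y\in L^\infty$ and $\gamma\in[0,1]$. (e) Normalization: $\mathrm{ES}_\Lambda(t)=t$ for all $t\in\mathbb R$. (f) Cash subadditivity: $\mathrm{ES}_\Lambda(X+m)\le\mathrm{ES}_\Lambda(X)+m$ for all $X\in L^\infty$ and $m\ge0$. (g) SSD-consistency: $\mathrm{ES}_\Lambda(X)\ge\mathrm{ES}_\Lambda(Y)$ for all $X,Y\in L^\infty$ such that $\mathbb E[f(X)]\ge\mathbb E[f(Y)]$ for every increasing (in the weak sense) convex $f:\mathbb R\to\mathbb R$. (h) Quasi-concavity in mixtures: $\mathrm{ES}_\Lambda(X)$ depends on $X\in L^\infty$ only through its distribution,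 and $\mathrm{ES}_\Lambda(Z)\ge\min\{\mathrm{ES}_\Lambda(X),\mathrm{ES}_\Lambda(Y)\}$ whenever $X,Y,Z\in L^\infty$ have distributions $F$, $G$ and $\gamma F+(1-\gamma)G$ for some $\gamma\in[0,1]$. (i) If $\Lambda(x)<1$ for all $x\in\mathbb R$, then $\mathrm{ES}_\Lambda$ is $L^1$-continuous: $\mathrm{ES}_\Lambda(X_n)\to\mathrm{ES}_\Lambda(X)$ for all $X,X_1,X_2,\dots\in L^\infty$ with $\mathbb E|X_n-X|\to0$. -/

import Mathlib

open MeasureTheory Filter Topology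
open scoped ENNReal

namespace RiskMeasure

noncomputable section

variable {Ω : Type*} [MeasurableSpace Ω]

/-- The measure space has no atoms: every measurable set of positive measure has a measurable
subset of strictly smaller positive measure. -/
def IsAtomless (P : Measure Ω) : Prop :=
  ∀ A : Set Ω, MeasurableSet A → 0 < P A →
    ∃ B : Set Ω, B ⊆ A ∧ MeasurableSet B ∧ 0 < P B ∧ P B < P A

/-- The essentially bounded random variables. -/
def LInf (P : Measure Ω) : Set (Ω → ℝ) := {X | MemLp X ∞ P}

/-- Value-at-Risk at level `α`, the left quantile, as an infimum in `[-∞, ∞]`. -/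
def VaR (P : Measure Ω) (α : ℝ) (X : Ω → ℝ) : EReal :=
  ⨅ (x : ℝ) (_ : α ≤ P.real {ω | X ω ≤ x}), (x : EReal)

/-- The `Λ`-Value-at-Risk, as an infimum in `[-∞, ∞]`. -/
def LambdaVaR (P : Measure Ω) (Λ : ℝ → ℝ) (X : Ω → ℝ) : EReal :=
  ⨅ (x : ℝ) (_ : Λ x ≤ P.real {ω | X ω ≤ x}), (x : EReal)

/-- Expected Shortfall at level `α ∈ [0, 1]`. For essentially bounded `X` the number `VaR_β(X)` is
finite for every `β ∈ (0, 1]`, and it is bounded and increasing in `β`, so the integrand is the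
real number `VaR_β(X)` and the integral exists. -/
def ES (P : Measure Ω) (α : ℝ) (X : Ω → ℝ) : EReal :=
  if α = 1 then VaR P 1 X
  else ((1 / (1 - α) * ∫ β in α..1, (VaR P β X).toReal : ℝ) : EReal)

/-- The `Λ`-Expected Shortfall `sup_x (ES_{Λ(x)}(X) ∧ x)`, as a supremum in `[-∞, ∞]`. -/
def LambdaES (P : Measure Ω) (Λ : ℝ → ℝ) (X : Ω → ℝ) : EReal :=
  ⨆ x : ℝ, min (ES P (Λ x) X) (x : EReal)

/-! Properties of a risk measure on the space of essentially bounded random variables. -/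

/-- Monotonicity. -/
def IsMonotone (P : Measure Ω) (ρ : (Ω → ℝ) → EReal) : Prop :=
  ∀ X ∈ LInf P, ∀ Y ∈ LInf P, Y ≤ᵐ[P] X → ρ Y ≤ ρ X

/-- Quasi-convexity. -/
def IsQuasiConvex (P : Measure Ω) (ρ : (Ω → ℝ) → EReal) : Prop :=
  ∀ X ∈ LInf P, ∀ Y ∈ LInf P, ∀ γ ∈ Set.Icc (0 : ℝ) 1,
    ρ (fun ω => γ * X ω + (1 - γ) * Y ω) ≤ max (ρ X) (ρ Y)

/-- Normalization. -/
def IsNormalized (ρ : (Ω → ℝ) → EReal) : Prop :=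
  ∀ t : ℝ, ρ (fun _ => t) = (t : EReal)

/-- Cash subadditivity. -/
def IsCashSubadditive (P : Measure Ω) (ρ : (Ω → ℝ) → EReal) : Prop :=
  ∀ X ∈ LInf P, ∀ m : ℝ, 0 ≤ m → ρ (fun ω => X ω + m) ≤ ρ X + (m : EReal)

/-- `X` dominates `Y` in increasing convex order. -/
def IcxDominates (P : Measure Ω) (X Y : Ω → ℝ) : Prop :=
  ∀ f : ℝ → ℝ, Monotone f → ConvexOn ℝ Set.univ f →
    ∫ ω, f (Y ω) ∂P ≤ ∫ ω, f (X ω) ∂P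

/-- SSD-consistency. -/
def IsSSDConsistent (P : Measure Ω) (ρ : (Ω → ℝ) → EReal) : Prop :=
  ∀ X ∈ LInf P, ∀ Y ∈ LInf P, IcxDominates P X Y → ρ Y ≤ ρ X

/-- Law invariance. -/
def IsLawInvariant (P : Measure Ω) (ρ : (Ω → ℝ) → EReal) : Prop :=
  ∀ X ∈ LInf P, ∀ Y ∈ LInf P, P.map X = P.map Y → ρ X = ρ Y

/-- Quasi-concavity in mixtures: `ρ` is law invariant, and `F ↦ ρ (X_F)` is quasi-concave on the
compactly supported distributions on `ℝ`. Such distributions are exactly the laws of the essentially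
bounded random variables (on an atomless space), so `F`, `G` and `γ F + (1 - γ) G` are given here as
the laws of `X`, `Y` and `Z`. -/
def IsQuasiConcaveInMixtures (P : Measure Ω) (ρ : (Ω → ℝ) → EReal) : Prop :=
  IsLawInvariant P ρ ∧
  ∀ X ∈ LInf P, ∀ Y ∈ LInf P, ∀ Z ∈ LInf P, ∀ γ ∈ Set.Icc (0 : ℝ) 1,
    P.map Z = ENNReal.ofReal γ • P.map X + ENNReal.ofReal (1 - γ) • P.map Y →
    min (ρ X) (ρ Y) ≤ ρ Z

/-- `L¹`-continuity. -/
def IsL1Continuous (P : Measure Ω) (ρ : (Ω → ℝ) → EReal) : Prop :=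
  ∀ X ∈ LInf P, ∀ Xn : ℕ → Ω → ℝ, (∀ n, Xn n ∈ LInf P) →
    Tendsto (fun n => eLpNorm (Xn n - X) 1 P) atTop (𝓝 0) →
    Tendsto (fun n => ρ (Xn n)) atTop (𝓝 (ρ X))

end

end RiskMeasure

namespace RiskMeasure

variable {Ω : Type*} [MeasurableSpace Ω] {P : Measure Ω} {X Y Z : Ω → ℝ}

/-! Everything is read off from sublevel sets. By Rockafellar–Uryasev (`ES_le_iff`), `ES_α(X) ≤ t`
holds iff some `q ≤ t` satisfies `E(X-q)⁺ ≤ (1-α)(t-q)`. So `X` enters only through its stop-loss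
transform, and each property of ES amounts to transporting a witness `q`.

Since `Λ` is decreasing, comparing `ES_Λ(X)` with a real `t` involves only the single level `Λ(t)`:
`ES_Λ(X) < t` gives `ES_{Λ(t)}(X) < t` (`ES_lt_of_LambdaES_lt`), and `ES_{Λ(t)}(X) ≤ t` gives
`ES_Λ(X) ≤ t` (`LambdaES_le_of_ES_le`). Testing against all real `t` above the right-hand side then
lifts the properties of ES at a fixed level to `ES_Λ`. -/

lemma exists_bound_of_mem_LInf (hX : X ∈ LInf P) : ∃ c : ℝ, ∀ᵐ ω ∂P, |X ω| ≤ c := by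
  have h : eLpNormEssSup X P < ∞ := by
    have := hX.2
    rwa [eLpNorm_exponent_top] at this
  refine ⟨(eLpNormEssSup X P).toReal, ?_⟩
  filter_upwards [ae_le_eLpNormEssSup (f := X) (μ := P)] with ω hω
  rw [← Real.norm_eq_abs, ← toReal_enorm]
  exact ENNReal.toReal_mono h.ne hω

/-- Positivity of the level matters: at level `0` every real is admissible and the infimum is `⊥`.
-/
lemma le_VaR_of_ae_le {c : ℝ} (hc : ∀ᵐ ω ∂P, c ≤ X ω) {β : ℝ}
    (hβ : 0 < β) : (c : EReal) ≤ VaR P β X := by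
  refine le_iInf₂ fun x hx => ?_
  by_contra! hlt
  have hlt' : x < c := by exact_mod_cast hlt
  have h0 : P {ω | X ω ≤ x} = 0 :=
    measure_mono_null (fun ω (hω : X ω ≤ x) => not_le.2 (hω.trans_lt hlt')) hc
  rw [measureReal_def, h0] at hx
  simp at hx
  linarith

lemma convex_comb_mem_LInf (hX : X ∈ LInf P) (hY : Y ∈ LInf P) (a b : ℝ) :
    (fun ω => a * X ω + b * Y ω) ∈ LInf P :=
  MemLp.add ((hX : MemLp X ∞ P).const_mul a) ((hY : MemLp Y ∞ P).const_mul b)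

lemma le_LambdaES {Λ : ℝ → ℝ} {t : ℝ} (h : (t : EReal) ≤ ES P (Λ t) X) :
    (t : EReal) ≤ LambdaES P Λ X :=
  (le_min h le_rfl).trans (le_iSup (fun x : ℝ => min (ES P (Λ x) X) (x : EReal)) t)

lemma LambdaES_mono_of_ES_mono {Λ : ℝ → ℝ} (h : ∀ x, ES P (Λ x) Y ≤ ES P (Λ x) X) :
    LambdaES P Λ Y ≤ LambdaES P Λ X :=
  iSup_mono fun x => min_le_min_right _ (h x)

lemma ES_lt_of_LambdaES_lt {Λ : ℝ → ℝ} {t : ℝ} (h : LambdaES P Λ X < (t : EReal)) :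
    ES P (Λ t) X < (t : EReal) := by
  by_contra! hle
  exact (le_LambdaES hle).not_gt h

variable [IsProbabilityMeasure P]

lemma integrable_of_mem_LInf (hX : X ∈ LInf P) : Integrable X P :=
  (hX : MemLp X ∞ P).integrable le_top

lemma integrable_posPart_sub (hX : X ∈ LInf P) (q : ℝ) :
    Integrable (fun ω => max (X ω - q) 0) P :=
  ((integrable_of_mem_LInf hX).sub (integrable_const q)).pos_part

/-! ### Quantile functions -/

lemma measureReal_le_eq_cdf (hX : AEMeasurable X P) (x : ℝ) :
    P.real {ω | X ω ≤ x} = ProbabilityTheory.cdf (P.map X) x := by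
  have := Measure.isProbabilityMeasure_map hX
  rw [ProbabilityTheory.cdf_eq_real, measureReal_def, measureReal_def,
    Measure.map_apply_of_aemeasurable hX measurableSet_Iic]
  rfl

/-- The quantile function is the left adjoint of the distribution function. -/
lemma VaR_le_iff (hX : AEMeasurable X P) (β x : ℝ) :
    VaR P β X ≤ (x : EReal) ↔ β ≤ P.real {ω | X ω ≤ x} := by
  constructor
  · intro h
    have key : ∀ y, x < y → β ≤ ProbabilityTheory.cdf (P.map X) y := by
      intro y hy
      have hlt : VaR P β X < (y : EReal) := h.trans_lt (by exact_mod_cast hy)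
      simp only [VaR, iInf_lt_iff] at hlt
      obtain ⟨z, hz, hzy⟩ := hlt
      rw [measureReal_le_eq_cdf hX] at hz
      exact hz.trans (ProbabilityTheory.monotone_cdf _ (by exact_mod_cast hzy.le))
    rw [measureReal_le_eq_cdf hX]
    have hc := ((ProbabilityTheory.cdf (P.map X)).right_continuous x).mono Set.Ioi_subset_Ici_self
    refine ge_of_tendsto hc.tendsto ?_
    filter_upwards [self_mem_nhdsWithin] with y hy using key y hy
  · intro h
    exact iInf₂_le x h

lemma one_le_measureReal_le_iff (hX : AEMeasurable X P) (t : ℝ) :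
    1 ≤ P.real {ω | X ω ≤ t} ↔ ∀ᵐ ω ∂P, X ω ≤ t := by
  have hset : NullMeasurableSet {ω | X ω ≤ t} P := nullMeasurableSet_le hX aemeasurable_const
  rw [measureReal_le_one.ge_iff_eq, measureReal_def, ENNReal.toReal_eq_one_iff]
  exact (mem_ae_iff_prob_eq_one₀ hset).symm

lemma VaR_le_of_ae_le {c : ℝ} (hX : AEMeasurable X P) (hc : ∀ᵐ ω ∂P, X ω ≤ c) {β : ℝ}
    (hβ : β ≤ 1) : VaR P β X ≤ (c : EReal) := by
  exact (VaR_le_iff hX β c).2 (hβ.trans ((one_le_measureReal_le_iff hX c).2 hc))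

lemma coe_toReal_VaR (hX : X ∈ LInf P) {β : ℝ} (hβ : 0 < β) (hβ1 : β ≤ 1) :
    ((VaR P β X).toReal : EReal) = VaR P β X := by
  obtain ⟨c, hc⟩ := exists_bound_of_mem_LInf hX
  have h1 := VaR_le_of_ae_le hX.1.aemeasurable (hc.mono fun ω h => (abs_le.1 h).2) hβ1
  have h2 := le_VaR_of_ae_le (hc.mono fun ω h => (abs_le.1 h).1) hβ
  exact EReal.coe_toReal (ne_top_of_le_ne_top (EReal.coe_ne_top _) h1)
    (ne_bot_of_le_ne_bot (EReal.coe_ne_bot _) h2)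

lemma toReal_VaR_le_iff (hX : X ∈ LInf P) {β : ℝ} (hβ : 0 < β) (hβ1 : β ≤ 1) (x : ℝ) :
    (VaR P β X).toReal ≤ x ↔ β ≤ P.real {ω | X ω ≤ x} := by
  rw [← VaR_le_iff hX.1.aemeasurable, ← coe_toReal_VaR hX hβ hβ1]
  simp

lemma monotoneOn_toReal_VaR (hX : X ∈ LInf P) :
    MonotoneOn (fun β => (VaR P β X).toReal) (Set.Ioc 0 1) := by
  intro a ha b hb hab
  refine (toReal_VaR_le_iff hX ha.1 ha.2 _).2 (hab.trans ?_)
  exact (toReal_VaR_le_iff hX hb.1 hb.2 _).1 le_rfl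

lemma aemeasurable_toReal_VaR (hX : X ∈ LInf P) :
    AEMeasurable (fun β => (VaR P β X).toReal) (volume.restrict (Set.Ioc 0 1)) :=
  aemeasurable_restrict_of_monotoneOn measurableSet_Ioc (monotoneOn_toReal_VaR hX)

/-- The quantile function of `X`, under the uniform distribution, has the law of `X`. -/
lemma map_toReal_VaR (hX : X ∈ LInf P) :
    (volume.restrict (Set.Ioc (0 : ℝ) 1)).map (fun β => (VaR P β X).toReal) = P.map X := by
  have hXm := hX.1.aemeasurable
  have := Measure.isProbabilityMeasure_map hXm
  have : IsFiniteMeasure ((volume.restrict (Set.Ioc (0 : ℝ) 1)).map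
    (fun β => (VaR P β X).toReal)) := Measure.isFiniteMeasure_map _ _
  refine Measure.ext_of_Iic _ _ fun x => ?_
  rw [Measure.map_apply_of_aemeasurable (aemeasurable_toReal_VaR hX) measurableSet_Iic,
    Measure.map_apply_of_aemeasurable hXm measurableSet_Iic,
    Measure.restrict_apply' measurableSet_Ioc]
  have hset : (fun β => (VaR P β X).toReal) ⁻¹' Set.Iic x ∩ Set.Ioc 0 1
      = Set.Ioc 0 (P.real {ω | X ω ≤ x}) := by
    ext β
    simp only [Set.mem_inter_iff, Set.mem_preimage, Set.mem_Iic, Set.mem_Ioc]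
    constructor
    · rintro ⟨h, h0, h1⟩
      exact ⟨h0, (toReal_VaR_le_iff hX h0 h1 x).1 h⟩
    · rintro ⟨h0, h⟩
      have h1 : β ≤ 1 := h.trans measureReal_le_one
      exact ⟨(toReal_VaR_le_iff hX h0 h1 x).2 h, h0, h1⟩
  rw [hset, Real.volume_Ioc, sub_zero, ofReal_measureReal]
  rfl

lemma integral_comp_toReal_VaR (hX : X ∈ LInf P) {f : ℝ → ℝ} (hf : Continuous f) :
    ∫ β in Set.Ioc (0 : ℝ) 1, f (VaR P β X).toReal = ∫ ω, f (X ω) ∂P := by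
  rw [← integral_map (aemeasurable_toReal_VaR hX) hf.aestronglyMeasurable,
    map_toReal_VaR hX, integral_map hX.1.aemeasurable hf.aestronglyMeasurable]

lemma integrableOn_toReal_VaR (hX : X ∈ LInf P) :
    IntegrableOn (fun β => (VaR P β X).toReal) (Set.Ioc 0 1) := by
  have h : Integrable id (P.map X) :=
    (integrable_map_measure aestronglyMeasurable_id hX.1.aemeasurable).2
      (integrable_of_mem_LInf hX)
  rw [← map_toReal_VaR hX] at h
  exact (integrable_map_measure aestronglyMeasurable_id (aemeasurable_toReal_VaR hX)).1 h

/-! ### The Rockafellar–Uryasev representation -/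

lemma exists_quantile (hX : X ∈ LInf P) {α : ℝ} (h0 : 0 ≤ α) (h1 : α < 1) :
    ∃ q : ℝ, (∀ β ∈ Set.Ioc 0 α, (VaR P β X).toReal ≤ q) ∧
      ∀ β ∈ Set.Ioc α 1, q ≤ (VaR P β X).toReal := by
  rcases h0.eq_or_lt with rfl | h0
  -- `VaR P 0 X` is `⊥`, so an essential lower bound of `X` serves as the quantile.
  · obtain ⟨c, hc⟩ := exists_bound_of_mem_LInf hX
    refine ⟨-c, by simp, fun β hβ => ?_⟩
    have h2 := le_VaR_of_ae_le (hc.mono fun ω h => (abs_le.1 h).1) hβ.1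
    rw [← coe_toReal_VaR hX hβ.1 hβ.2] at h2
    exact_mod_cast h2
  · refine ⟨(VaR P α X).toReal, fun β hβ => ?_, fun β hβ => ?_⟩
    · exact monotoneOn_toReal_VaR hX ⟨hβ.1, hβ.2.trans h1.le⟩ ⟨h0, h1.le⟩ hβ.2
    · exact monotoneOn_toReal_VaR hX ⟨h0, h1.le⟩ ⟨h0.trans hβ.1, hβ.2⟩ hβ.1.le

/-- The sublevel sets of Expected Shortfall in the Rockafellar–Uryasev representation; with the
constraint `q ≤ t`, this form covers the level `α = 1`. -/
lemma ES_le_iff (hX : X ∈ LInf P) {α : ℝ} (hα : α ∈ Set.Icc (0 : ℝ) 1) (t : ℝ) :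
    ES P α X ≤ (t : EReal) ↔
      ∃ q ≤ t, ∫ ω, max (X ω - q) 0 ∂P ≤ (1 - α) * (t - q) := by
  obtain ⟨h0, h1⟩ := hα
  rcases h1.eq_or_lt with rfl | h1
  · rw [ES, if_pos rfl, VaR_le_iff hX.1.aemeasurable,
      one_le_measureReal_le_iff hX.1.aemeasurable]
    constructor
    · intro h
      refine ⟨t, le_rfl, ?_⟩
      rw [integral_eq_zero_of_ae]
      · simp
      · filter_upwards [h] with ω hω
        simpa using hω
    · rintro ⟨q, hq, h⟩
      have hz : ∫ ω, max (X ω - q) 0 ∂P = 0 :=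
        le_antisymm (by simpa using h) (integral_nonneg fun ω => le_max_right _ _)
      have hz := (integral_eq_zero_iff_of_nonneg (fun ω => le_max_right (X ω - q) 0)
        (integrable_posPart_sub hX q)).1 hz
      filter_upwards [hz] with ω hω
      have : max (X ω - q) 0 = 0 := hω
      have := le_max_left (X ω - q) 0
      linarith
  · have hpos : 0 < 1 - α := by linarith
    set Q : ℝ → ℝ := fun β => (VaR P β X).toReal with hQ
    have hint := integrableOn_toReal_VaR hX
    have hsub1 : Set.Ioc α 1 ⊆ Set.Ioc 0 1 := Set.Ioc_subset_Ioc_left h0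
    have hsub0 : Set.Ioc 0 α ⊆ Set.Ioc 0 1 := Set.Ioc_subset_Ioc_right h1.le
    have hposint : ∀ q, IntegrableOn (fun β => max (Q β - q) 0) (Set.Ioc 0 1) := fun q =>
      (hint.sub (integrable_const q)).pos_part
    have hE : ∀ q, ∫ ω, max (X ω - q) 0 ∂P
        = (∫ β in Set.Ioc 0 α, max (Q β - q) 0) + ∫ β in Set.Ioc α 1, max (Q β - q) 0 := by
      intro q
      rw [← integral_comp_toReal_VaR hX (f := fun x => max (x - q) 0) (by fun_prop),
        ← Set.Ioc_union_Ioc_eq_Ioc h0 h1.le,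
        setIntegral_union (Set.Ioc_disjoint_Ioc_of_le le_rfl) measurableSet_Ioc
          ((hposint q).mono_set hsub0) ((hposint q).mono_set hsub1)]
    have hI : ∀ q, ∫ β in Set.Ioc α 1, (Q β - q) = (∫ β in α..1, Q β) - (1 - α) * q := by
      intro q
      rw [integral_sub (hint.mono_set hsub1) (integrable_const q),
        intervalIntegral.integral_of_le h1.le]
      simp [h1.le, hQ]
    have hES : ES P α X ≤ (t : EReal) ↔ ∫ β in α..1, Q β ≤ (1 - α) * t := by
      rw [ES, if_neg h1.ne, EReal.coe_le_coe_iff, one_div, inv_mul_le_iff₀ hpos]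
    rw [hES]
    constructor
    · intro h
      -- At an `α`-quantile `q`, the integrand `(Q - q)⁺` vanishes on `(0, α]` and equals `Q - q` on
      -- `(α, 1]`, so the reverse inequality below becomes an equality.
      obtain ⟨q, hq0, hq1⟩ := exists_quantile hX h0 h1
      have hle : ∫ ω, max (X ω - q) 0 ∂P ≤ (1 - α) * (t - q) := by
        rw [hE, setIntegral_congr_fun measurableSet_Ioc
            (g := fun _ => (0 : ℝ)) (fun β hβ => max_eq_right (sub_nonpos.2 (hq0 β hβ))),
          setIntegral_congr_fun measurableSet_Ioc
            (fun β hβ => max_eq_left (sub_nonneg.2 (hq1 β hβ))), hI]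
        simp only [integral_zero]
        linarith
      refine ⟨q, ?_, hle⟩
      have h3 : 0 ≤ (1 - α) * (t - q) :=
        (integral_nonneg fun ω => le_max_right _ _).trans hle
      linarith [(mul_nonneg_iff_of_pos_left hpos).1 h3]
    · rintro ⟨q, -, h⟩
      have h2 : ∫ β in Set.Ioc α 1, (Q β - q) ≤ ∫ β in Set.Ioc α 1, max (Q β - q) 0 :=
        integral_mono ((hint.mono_set hsub1).sub (integrable_const q))
          ((hposint q).mono_set hsub1) fun β => le_max_left _ _
      have h3 : 0 ≤ ∫ β in Set.Ioc 0 α, max (Q β - q) 0 :=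
        integral_nonneg fun ω => le_max_right _ _
      rw [hE] at h
      rw [hI] at h2
      linarith

/-! ### Expected Shortfall at a fixed level -/

/-- The same `q` works: `t - q ≥ 0`, so `(1 - α)(t - q)` decreases in `α`. -/
lemma ES_mono_level (hX : X ∈ LInf P) {α α' : ℝ} (hα : α ∈ Set.Icc (0 : ℝ) 1)
    (hα' : α' ∈ Set.Icc (0 : ℝ) 1) (h : α ≤ α') : ES P α X ≤ ES P α' X := by
  refine EReal.le_of_forall_lt_iff_le.1 fun t ht => ?_
  obtain ⟨q, hq, hle⟩ := (ES_le_iff hX hα' t).1 ht.le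
  exact (ES_le_iff hX hα t).2 ⟨q, hq, hle.trans (by nlinarith)⟩

lemma ES_const_le_iff {α : ℝ} (hα : α ∈ Set.Icc (0 : ℝ) 1) (c t : ℝ) :
    ES P α (fun _ => c) ≤ (t : EReal) ↔ c ≤ t := by
  rw [ES_le_iff (memLp_const c) hα]
  obtain ⟨h0, h1⟩ := hα
  simp only [integral_const, probReal_univ, smul_eq_mul, one_mul]
  constructor
  · rintro ⟨q, hq, h⟩
    have := le_max_left (c - q) 0
    nlinarith
  · intro h
    exact ⟨t, le_rfl, by simpa using h⟩

lemma ES_mono_of_integral_posPart_le (hX : X ∈ LInf P) (hY : Y ∈ LInf P)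
    (h : ∀ q : ℝ, ∫ ω, max (Y ω - q) 0 ∂P ≤ ∫ ω, max (X ω - q) 0 ∂P)
    {α : ℝ} (hα : α ∈ Set.Icc (0 : ℝ) 1) : ES P α Y ≤ ES P α X := by
  refine EReal.le_of_forall_lt_iff_le.1 fun t ht => ?_
  obtain ⟨q, hq, hle⟩ := (ES_le_iff hX hα t).1 ht.le
  exact (ES_le_iff hY hα t).2 ⟨q, hq, (h q).trans hle⟩

lemma ES_mono (hX : X ∈ LInf P) (hY : Y ∈ LInf P) (h : Y ≤ᵐ[P] X)
    {α : ℝ} (hα : α ∈ Set.Icc (0 : ℝ) 1) : ES P α Y ≤ ES P α X := by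
  refine ES_mono_of_integral_posPart_le hX hY (fun q => ?_) hα
  refine integral_mono_ae (integrable_posPart_sub hY q) (integrable_posPart_sub hX q) ?_
  filter_upwards [h] with ω hω
  gcongr

lemma VaR_le_ES (hX : X ∈ LInf P) {α : ℝ} (hα : α ∈ Set.Icc (0 : ℝ) 1) :
    VaR P α X ≤ ES P α X := by
  refine EReal.le_of_forall_lt_iff_le.1 fun t ht => ?_
  obtain ⟨q, hq, hle⟩ := (ES_le_iff hX hα t).1 ht.le
  have hXm := hX.1.aemeasurable
  rw [VaR_le_iff hXm]
  -- For `q < t`, Markov's inequality for `(X - q)⁺` at height `t - q` bounds `P(X > t)` by `1 - α`.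
  -- It is void for `q = t`, where `E(X - t)⁺ = 0` forces `X ≤ t` a.s.
  rcases hq.eq_or_lt with rfl | hq
  · have hz : ∫ ω, max (X ω - q) 0 ∂P = 0 :=
      le_antisymm (by simpa using hle) (integral_nonneg fun ω => le_max_right _ _)
    have hz := (integral_eq_zero_iff_of_nonneg (fun ω => le_max_right (X ω - q) 0)
      (integrable_posPart_sub hX q)).1 hz
    refine hα.2.trans ((one_le_measureReal_le_iff hXm q).2 ?_)
    filter_upwards [hz] with ω hω
    have h0 : max (X ω - q) 0 = 0 := hω
    linarith [le_max_left (X ω - q) 0]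
  · have hset : NullMeasurableSet {ω | X ω ≤ t} P := nullMeasurableSet_le hXm aemeasurable_const
    have hmarkov := mul_meas_ge_le_integral_of_nonneg
      (ae_of_all P fun ω => le_max_right (X ω - q) 0) (integrable_posPart_sub hX q) (t - q)
    have hsub : P.real {ω | X ω ≤ t}ᶜ ≤ P.real {ω | t - q ≤ max (X ω - q) 0} := by
      refine measureReal_mono fun ω hω => ?_
      have : t < X ω := not_le.1 hω
      exact le_max_of_le_left (sub_le_sub_right this.le q)
    rw [probReal_compl_eq_one_sub₀ hset] at hsub
    have hpos : 0 < t - q := sub_pos.2 hq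
    nlinarith

/-- The stop-loss transform is affine in the law: if the bound at `q` failed for both `X` and `Y`,
it would fail for the mixture. -/
lemma min_ES_le_of_integral_posPart_eq (hX : X ∈ LInf P) (hY : Y ∈ LInf P) (hZ : Z ∈ LInf P)
    {γ : ℝ} (hγ : γ ∈ Set.Icc (0 : ℝ) 1)
    (h : ∀ q : ℝ, ∫ ω, max (Z ω - q) 0 ∂P
      = γ * ∫ ω, max (X ω - q) 0 ∂P + (1 - γ) * ∫ ω, max (Y ω - q) 0 ∂P)
    {α : ℝ} (hα : α ∈ Set.Icc (0 : ℝ) 1) : min (ES P α X) (ES P α Y) ≤ ES P α Z := by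
  refine EReal.le_of_forall_lt_iff_le.1 fun t ht => ?_
  obtain ⟨q, hq, hle⟩ := (ES_le_iff hZ hα t).1 ht.le
  rw [min_le_iff, ES_le_iff hX hα, ES_le_iff hY hα]
  rw [h q] at hle
  by_contra! hlt
  have h1 := hlt.1 q hq
  have h2 := hlt.2 q hq
  obtain ⟨h3, h4⟩ := hγ
  rcases h3.eq_or_lt with rfl | h3
  · linarith
  · nlinarith

/-- `(x, q) ↦ (x - q)⁺` is jointly convex, so the witnesses for `X` and `Y` are combined with the
same weights. -/
lemma ES_convex_comb_le (hX : X ∈ LInf P) (hY : Y ∈ LInf P)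
    {γ : ℝ} (hγ : γ ∈ Set.Icc (0 : ℝ) 1) {α : ℝ} (hα : α ∈ Set.Icc (0 : ℝ) 1) :
    ES P α (fun ω => γ * X ω + (1 - γ) * Y ω) ≤ max (ES P α X) (ES P α Y) := by
  refine EReal.le_of_forall_lt_iff_le.1 fun t ht => ?_
  obtain ⟨hx, hy⟩ := max_lt_iff.1 ht
  obtain ⟨q, hq, hle⟩ := (ES_le_iff hX hα t).1 hx.le
  obtain ⟨r, hr, hle'⟩ := (ES_le_iff hY hα t).1 hy.le
  obtain ⟨h0, h1⟩ := hγ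
  have h1' : 0 ≤ 1 - γ := sub_nonneg.2 h1
  refine (ES_le_iff (convex_comb_mem_LInf hX hY _ _) hα t).2
    ⟨γ * q + (1 - γ) * r, by nlinarith, ?_⟩
  have hint := ((integrable_posPart_sub hX q).const_mul γ).add
    ((integrable_posPart_sub hY r).const_mul (1 - γ))
  calc ∫ ω, max (γ * X ω + (1 - γ) * Y ω - (γ * q + (1 - γ) * r)) 0 ∂P
      ≤ ∫ ω, (γ * max (X ω - q) 0 + (1 - γ) * max (Y ω - r) 0) ∂P := by
        refine integral_mono
          (integrable_posPart_sub (convex_comb_mem_LInf hX hY _ _) _) hint fun ω => ?_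
        refine max_le ?_ (by positivity)
        have e1 := mul_le_mul_of_nonneg_left (le_max_left (X ω - q) 0) h0
        have e2 := mul_le_mul_of_nonneg_left (le_max_left (Y ω - r) 0) h1'
        linarith
    _ = γ * ∫ ω, max (X ω - q) 0 ∂P + (1 - γ) * ∫ ω, max (Y ω - r) 0 ∂P := by
        rw [integral_add ((integrable_posPart_sub hX q).const_mul γ)
          ((integrable_posPart_sub hY r).const_mul (1 - γ)), integral_const_mul,
          integral_const_mul]
    _ ≤ γ * ((1 - α) * (t - q)) + (1 - γ) * ((1 - α) * (t - r)) := by gcongr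
    _ = (1 - α) * (t - (γ * q + (1 - γ) * r)) := by ring

lemma add_const_mem_LInf (hX : X ∈ LInf P) (m : ℝ) : (fun ω => X ω + m) ∈ LInf P :=
  MemLp.add (hX : MemLp X ∞ P) (memLp_const m)

lemma ES_add_const_le (hX : X ∈ LInf P) {α t m : ℝ} (hα : α ∈ Set.Icc (0 : ℝ) 1)
    (h : ES P α X ≤ ((t - m : ℝ) : EReal)) : ES P α (fun ω => X ω + m) ≤ (t : EReal) := by
  obtain ⟨q, hq, hle⟩ := (ES_le_iff hX hα _).1 h
  refine (ES_le_iff (add_const_mem_LInf hX m) hα t).2 ⟨q + m, by linarith, ?_⟩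
  simp only [add_sub_add_right_eq_sub]
  linarith

/-- The sublevel sets of Expected Shortfall at a level below `1` are stable under perturbations
that are small in `L¹`. -/
lemma ES_le_add_of_integral_abs_sub_le (hX : X ∈ LInf P) (hY : Y ∈ LInf P) {α s t : ℝ}
    (hα : α ∈ Set.Icc (0 : ℝ) 1) (hst : s ≤ t)
    (h : ∫ ω, |Y ω - X ω| ∂P ≤ (1 - α) * (t - s)) (hs : ES P α X ≤ (s : EReal)) :
    ES P α Y ≤ (t : EReal) := by
  obtain ⟨q, hq, hle⟩ := (ES_le_iff hX hα _).1 hs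
  refine (ES_le_iff hY hα t).2 ⟨q, hq.trans hst, ?_⟩
  have habs : Integrable (fun ω => |Y ω - X ω|) P :=
    ((integrable_of_mem_LInf hY).sub (integrable_of_mem_LInf hX)).abs
  have : ∫ ω, max (Y ω - q) 0 ∂P ≤ ∫ ω, (max (X ω - q) 0 + |Y ω - X ω|) ∂P := by
    refine integral_mono (integrable_posPart_sub hY q)
      ((integrable_posPart_sub hX q).add habs) fun ω => ?_
    refine max_le ?_ (by positivity)
    linarith [le_abs_self (Y ω - X ω), le_max_left (X ω - q) 0]
  rw [integral_add (integrable_posPart_sub hX q) habs] at this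
  linarith

/-! ### From Expected Shortfall to `Λ`-Expected Shortfall -/

section LambdaES

variable {Λ Λ' : ℝ → ℝ}

lemma LambdaES_mono_level (h : ∀ x, Λ' x ≤ Λ x) (hΛ01 : ∀ x, Λ x ∈ Set.Icc (0 : ℝ) 1)
    (hΛ'01 : ∀ x, Λ' x ∈ Set.Icc (0 : ℝ) 1) (hX : X ∈ LInf P) :
    LambdaES P Λ' X ≤ LambdaES P Λ X :=
  iSup_mono fun x => min_le_min_right _ (ES_mono_level hX (hΛ'01 x) (hΛ01 x) (h x))

lemma LambdaVaR_le_LambdaES (hΛ01 : ∀ x, Λ x ∈ Set.Icc (0 : ℝ) 1) (hX : X ∈ LInf P) :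
    LambdaVaR P Λ X ≤ LambdaES P Λ X := by
  refine EReal.le_of_forall_lt_iff_le.1 fun t ht => ?_
  refine iInf₂_le t ?_
  rw [← VaR_le_iff hX.1.aemeasurable]
  exact (VaR_le_ES hX (hΛ01 t)).trans (ES_lt_of_LambdaES_lt ht).le

lemma isMonotone_LambdaES (hΛ01 : ∀ x, Λ x ∈ Set.Icc (0 : ℝ) 1) :
    IsMonotone P (LambdaES P Λ) := fun _ hX _ hY h =>
  LambdaES_mono_of_ES_mono fun x => ES_mono hX hY h (hΛ01 x)

lemma isSSDConsistent_LambdaES (hΛ01 : ∀ x, Λ x ∈ Set.Icc (0 : ℝ) 1) :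
    IsSSDConsistent P (LambdaES P Λ) := by
  refine fun X hX Y hY h => LambdaES_mono_of_ES_mono fun x =>
    ES_mono_of_integral_posPart_le hX hY (fun q => h (fun y => max (y - q) 0) ?_ ?_) (hΛ01 x)
  · intro a b hab
    exact max_le_max_right _ (sub_le_sub_right hab q)
  · exact ((convexOn_id convex_univ).sub (concaveOn_const q convex_univ)).sup
      (convexOn_const 0 convex_univ)

/-- Equal laws dominate each other in increasing convex order. -/
lemma isLawInvariant_LambdaES (hΛ01 : ∀ x, Λ x ∈ Set.Icc (0 : ℝ) 1) :
    IsLawInvariant P (LambdaES P Λ) := by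
  have key : ∀ X ∈ LInf P, ∀ Y ∈ LInf P, P.map X = P.map Y →
      LambdaES P Λ Y ≤ LambdaES P Λ X := by
    refine fun X hX Y hY h => isSSDConsistent_LambdaES hΛ01 X hX Y hY fun f hf _ => le_of_eq ?_
    have hfm : ∀ μ : Measure ℝ, AEStronglyMeasurable f μ :=
      fun μ => hf.measurable.aestronglyMeasurable
    rw [← integral_map hX.1.aemeasurable (hfm _), ← integral_map hY.1.aemeasurable (hfm _), h]
  exact fun X hX Y hY h => le_antisymm (key Y hY X hX h.symm) (key X hX Y hY h)

lemma integral_of_map_eq_mix (hX : X ∈ LInf P) (hY : Y ∈ LInf P) (hZ : Z ∈ LInf P)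
    {γ : ℝ} (hγ : γ ∈ Set.Icc (0 : ℝ) 1)
    (h : P.map Z = ENNReal.ofReal γ • P.map X + ENNReal.ofReal (1 - γ) • P.map Y) (q : ℝ) :
    ∫ ω, max (Z ω - q) 0 ∂P
      = γ * ∫ ω, max (X ω - q) 0 ∂P + (1 - γ) * ∫ ω, max (Y ω - q) 0 ∂P := by
  set f : ℝ → ℝ := fun x => max (x - q) 0 with hf
  have hfm : ∀ μ : Measure ℝ, AEStronglyMeasurable f μ := fun μ =>
    Continuous.aestronglyMeasurable (by fun_prop)
  have hint : ∀ {W : Ω → ℝ}, W ∈ LInf P → Integrable f (P.map W) := fun hW =>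
    (integrable_map_measure (hfm _) hW.1.aemeasurable).2 (integrable_posPart_sub hW q)
  have hmap : ∀ {W : Ω → ℝ}, W ∈ LInf P → ∫ ω, max (W ω - q) 0 ∂P = ∫ x, f x ∂(P.map W) :=
    fun hW => (integral_map hW.1.aemeasurable (hfm _)).symm
  rw [hmap hX, hmap hY, hmap hZ, h,
    integral_add_measure ((hint hX).smul_measure ENNReal.ofReal_ne_top)
      ((hint hY).smul_measure ENNReal.ofReal_ne_top), integral_smul_measure,
    integral_smul_measure, ENNReal.toReal_ofReal hγ.1,
    ENNReal.toReal_ofReal (sub_nonneg.2 hγ.2), smul_eq_mul, smul_eq_mul]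

/-- Some `x > t` has `ES_{Λ(x)}(X) > t`, and `Λ(x) ≤ Λ(t)`, so the level can be raised to `Λ(t)`. -/
lemma lt_ES_of_lt_LambdaES (hΛ : Antitone Λ) (hΛ01 : ∀ x, Λ x ∈ Set.Icc (0 : ℝ) 1)
    (hX : X ∈ LInf P) {t : ℝ} (h : (t : EReal) < LambdaES P Λ X) :
    (t : EReal) < ES P (Λ t) X := by
  obtain ⟨x, hx⟩ := lt_iSup_iff.1 h
  obtain ⟨h1, h2⟩ := lt_min_iff.1 hx
  exact h1.trans_le (ES_mono_level hX (hΛ01 _) (hΛ01 _) (hΛ (by exact_mod_cast h2.le)))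

lemma LambdaES_le_of_ES_le (hΛ : Antitone Λ) (hΛ01 : ∀ x, Λ x ∈ Set.Icc (0 : ℝ) 1)
    (hX : X ∈ LInf P) {t : ℝ} (h : ES P (Λ t) X ≤ (t : EReal)) :
    LambdaES P Λ X ≤ (t : EReal) := by
  by_contra! hlt
  exact (lt_ES_of_lt_LambdaES hΛ hΛ01 hX hlt).not_ge h

lemma isNormalized_LambdaES (hΛ : Antitone Λ) (hΛ01 : ∀ x, Λ x ∈ Set.Icc (0 : ℝ) 1) :
    IsNormalized (LambdaES P Λ) := by
  intro t
  refine le_antisymm (LambdaES_le_of_ES_le hΛ hΛ01 (memLp_const t)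
    ((ES_const_le_iff (hΛ01 t) t t).2 le_rfl)) ?_
  refine EReal.le_of_forall_lt_iff_le.1 fun s hs => ?_
  exact_mod_cast (ES_const_le_iff (hΛ01 s) t s).1 (ES_lt_of_LambdaES_lt hs).le

lemma exists_LambdaES_eq_coe (hΛ : Antitone Λ) (hΛ01 : ∀ x, Λ x ∈ Set.Icc (0 : ℝ) 1)
    (hX : X ∈ LInf P) : ∃ r : ℝ, LambdaES P Λ X = (r : EReal) := by
  obtain ⟨c, hc⟩ := exists_bound_of_mem_LInf hX
  have h1 : LambdaES P Λ X ≤ (c : EReal) :=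
    isNormalized_LambdaES (P := P) hΛ hΛ01 c ▸ isMonotone_LambdaES hΛ01 _ (memLp_const c) X hX
      (hc.mono fun ω h => (abs_le.1 h).2)
  have h2 : ((-c : ℝ) : EReal) ≤ LambdaES P Λ X :=
    isNormalized_LambdaES (P := P) hΛ hΛ01 (-c) ▸ isMonotone_LambdaES hΛ01 X hX _
      (memLp_const (-c)) (hc.mono fun ω h => (abs_le.1 h).1)
  exact ⟨_, (EReal.coe_toReal (ne_top_of_le_ne_top (EReal.coe_ne_top _) h1)
    (ne_bot_of_le_ne_bot (EReal.coe_ne_bot _) h2)).symm⟩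

lemma isQuasiConvex_LambdaES (hΛ : Antitone Λ) (hΛ01 : ∀ x, Λ x ∈ Set.Icc (0 : ℝ) 1) :
    IsQuasiConvex P (LambdaES P Λ) := by
  intro X hX Y hY γ hγ
  refine EReal.le_of_forall_lt_iff_le.1 fun t ht => ?_
  obtain ⟨hx, hy⟩ := max_lt_iff.1 ht
  exact LambdaES_le_of_ES_le hΛ hΛ01 (convex_comb_mem_LInf hX hY _ _)
    ((ES_convex_comb_le hX hY hγ (hΛ01 t)).trans
      (max_le (ES_lt_of_LambdaES_lt hx).le (ES_lt_of_LambdaES_lt hy).le))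

/-- `Λ(t) ≤ Λ(t - m)` because `m ≥ 0`, so the bound at `t - m` passes to level `Λ(t)`, where adding
`m` shifts the witness `q` by `m`. -/
lemma isCashSubadditive_LambdaES (hΛ : Antitone Λ) (hΛ01 : ∀ x, Λ x ∈ Set.Icc (0 : ℝ) 1) :
    IsCashSubadditive P (LambdaES P Λ) := by
  intro X hX m hm
  obtain ⟨r, hr⟩ := exists_LambdaES_eq_coe hΛ hΛ01 hX
  refine EReal.le_of_forall_lt_iff_le.1 fun t ht => ?_
  rw [hr, ← EReal.coe_add, EReal.coe_lt_coe_iff] at ht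
  have h : LambdaES P Λ X < ((t - m : ℝ) : EReal) := by
    rw [hr, EReal.coe_lt_coe_iff]
    linarith
  exact LambdaES_le_of_ES_le hΛ hΛ01 (add_const_mem_LInf hX m)
    (ES_add_const_le hX (hΛ01 t) ((ES_mono_level hX (hΛ01 t) (hΛ01 (t - m))
      (hΛ (by linarith))).trans (ES_lt_of_LambdaES_lt h).le))

lemma isQuasiConcaveInMixtures_LambdaES (hΛ : Antitone Λ) (hΛ01 : ∀ x, Λ x ∈ Set.Icc (0 : ℝ) 1) :
    IsQuasiConcaveInMixtures P (LambdaES P Λ) := by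
  refine ⟨isLawInvariant_LambdaES hΛ01, fun X hX Y hY Z hZ γ hγ h => ?_⟩
  refine EReal.le_of_forall_lt_iff_le.1 fun t ht => ?_
  have hmin := (min_ES_le_of_integral_posPart_eq hX hY hZ hγ
    (integral_of_map_eq_mix hX hY hZ hγ h) (hΛ01 t)).trans (ES_lt_of_LambdaES_lt ht).le
  rcases min_le_iff.1 hmin with h | h
  · exact min_le_of_left_le (LambdaES_le_of_ES_le hΛ hΛ01 hX h)
  · exact min_le_of_right_le (LambdaES_le_of_ES_le hΛ hΛ01 hY h)

lemma isL1Continuous_LambdaES (hΛ : Antitone Λ) (hΛ01 : ∀ x, Λ x ∈ Set.Icc (0 : ℝ) 1)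
    (hlt : ∀ x, Λ x < 1) : IsL1Continuous P (LambdaES P Λ) := by
  intro X hX Xn hXn hlim
  have hdist : Tendsto (fun n => ∫ ω, |Xn n ω - X ω| ∂P) atTop (𝓝 0) := by
    have := (ENNReal.tendsto_toReal ENNReal.zero_ne_top).comp hlim
    refine this.congr fun n => ?_
    have hint := (integrable_of_mem_LInf (hXn n)).sub (integrable_of_mem_LInf hX)
    rw [Function.comp_apply, eLpNorm_one_eq_lintegral_enorm,
      ← integral_norm_eq_lintegral_enorm hint.1]
    rfl
  -- `Λ t < 1` makes the tolerance `(1 - Λ t)(b - a)` positive.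
  have hsmall : ∀ {t a b : ℝ}, a < b →
      ∀ᶠ n in atTop, ∫ ω, |Xn n ω - X ω| ∂P ≤ (1 - Λ t) * (b - a) := fun {t a b} hab =>
    hdist.eventually_le_const (mul_pos (sub_pos.2 (hlt t)) (sub_pos.2 hab))
  refine tendsto_order.2 ⟨fun a ha => ?_, fun a ha => ?_⟩
  · obtain ⟨t, hat, ht⟩ := EReal.lt_iff_exists_real_btwn.1 ha
    obtain ⟨u, htu, hu⟩ := EReal.lt_iff_exists_real_btwn.1 (lt_ES_of_lt_LambdaES hΛ hΛ01 hX ht)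
    have htu' : t < u := by exact_mod_cast htu
    filter_upwards [hsmall (t := t) htu'] with n hn
    refine hat.trans_le (le_LambdaES ?_)
    -- The perturbation bound is applied from `Xn n` to `X`: otherwise `ES_{Λ(t)}(X) ≤ u`.
    by_contra! hcon
    refine hu.not_ge (ES_le_add_of_integral_abs_sub_le (hXn n) hX (hΛ01 t) htu'.le ?_ hcon.le)
    simpa only [abs_sub_comm] using hn
  · obtain ⟨t, ht, hta⟩ := EReal.lt_iff_exists_real_btwn.1 ha
    obtain ⟨u, hu, hut⟩ := EReal.lt_iff_exists_real_btwn.1 (ES_lt_of_LambdaES_lt ht)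
    have hut' : u < t := by exact_mod_cast hut
    filter_upwards [hsmall (t := t) hut'] with n hn
    exact (LambdaES_le_of_ES_le hΛ hΛ01 (hXn n)
      (ES_le_add_of_integral_abs_sub_le hX (hXn n) (hΛ01 t) hut'.le hn hu.le)).trans_lt hta

end LambdaES

end RiskMeasure

theorem proposition3p5 {Ω : Type*} [MeasurableSpace Ω]
    (P : MeasureTheory.Measure Ω) [MeasureTheory.IsProbabilityMeasure P]
    (hP : RiskMeasure.IsAtomless P)
    (Λ Λ' : ℝ → ℝ) (hΛ : Antitone Λ) (hΛ01 : ∀ x, Λ x ∈ Set.Icc (0 : ℝ) 1)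
    (hΛ' : Antitone Λ') (hΛ'01 : ∀ x, Λ' x ∈ Set.Icc (0 : ℝ) 1) :
    -- the values are finite
    (∀ X ∈ RiskMeasure.LInf P, ∃ r : ℝ, RiskMeasure.LambdaES P Λ X = (r : EReal)) ∧
    -- increasing in Λ
    ((∀ x, Λ' x ≤ Λ x) →
      ∀ X ∈ RiskMeasure.LInf P, RiskMeasure.LambdaES P Λ' X ≤ RiskMeasure.LambdaES P Λ X) ∧
    -- monotone
    RiskMeasure.IsMonotone P (RiskMeasure.LambdaES P Λ) ∧
    -- dominates Λ-VaR
    (∀ X ∈ RiskMeasure.LInf P, RiskMeasure.LambdaVaR P Λ X ≤ RiskMeasure.LambdaES P Λ X) ∧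
    -- quasi-convex
    RiskMeasure.IsQuasiConvex P (RiskMeasure.LambdaES P Λ) ∧
    -- normalized
    RiskMeasure.IsNormalized (RiskMeasure.LambdaES P Λ) ∧
    -- cash subadditive
    RiskMeasure.IsCashSubadditive P (RiskMeasure.LambdaES P Λ) ∧
    -- SSD-consistent
    RiskMeasure.IsSSDConsistent P (RiskMeasure.LambdaES P Λ) ∧
    -- quasi-concave in mixtures
    RiskMeasure.IsQuasiConcaveInMixtures P (RiskMeasure.LambdaES P Λ) ∧
    -- continuous in L¹
    ((∀ x, Λ x < 1) → RiskMeasure.IsL1Continuous P (RiskMeasure.LambdaES P Λ)) := by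
  refine ⟨fun X hX => RiskMeasure.exists_LambdaES_eq_coe hΛ hΛ01 hX,
    fun h X hX => RiskMeasure.LambdaES_mono_level h hΛ01 hΛ'01 hX,
    RiskMeasure.isMonotone_LambdaES hΛ01,
    fun X hX => RiskMeasure.LambdaVaR_le_LambdaES hΛ01 hX,
    RiskMeasure.isQuasiConvex_LambdaES hΛ hΛ01,
    RiskMeasure.isNormalized_LambdaES hΛ hΛ01,
    RiskMeasure.isCashSubadditive_LambdaES hΛ hΛ01,
    RiskMeasure.isSSDConsistent_LambdaES hΛ01,
    RiskMeasure.isQuasiConcaveInMixtures_LambdaES hΛ hΛ01,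
    RiskMeasure.isL1Continuous_LambdaES hΛ hΛ01⟩
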